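/- Let $\Delta\ge 2$, $r\ge 0$ and $c\ge 1$ be integers, and let $\Sigma_{\mathrm{in}},\Sigma_{\mathrm{out}}$ be finite sets of input and output labels. **LCL problems.** Graphs are finite, directed and without self-loops; degrees count all incident edges, and distances and neighborhoods ignore edge directions. A labeling problem $\Pi$ assigns to each graph $G=(V,E)$ and each input labeling $x:V\to\Sigma_{\mathrm{in}}$ a set of permissible output labelings $V\to\Sigma_{\mathrm{out}}$, invariantly under isomorphism. It is an LCL problem with checking radius $r$ and degree constraint $\Delta$ if there is a family $\mathcal S$ of centered graphs of radius at most $r$ and maximum degree at most $\Delta$, with input and output labels on their nodes, such that for every graph $G$ of maximum degree at most $\Delta$ and every $x$, a labeling $y:V\to\Sigma_{\mathrm{out}}$ is permissible if and only if for every node $v$ the subgraph induced by the radius-$r$ neighborhood of $v$, centered at $v$ and labeled by the restrictions of $x$ and $y$, belongs to $\mathcal S$ up to isomorphism. A *rooted forest* is an oriented forest in which every node has outdegree at most $1$. **SLOCAL model.** Each node of an $n$-node input graph carries its input label and a unique identifier from $\{1,\dots,n^c\}$. A deterministic SLOCAL algorithm with locality $T(n)$ processes the nodes one by one in an adversarial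 order. When $v$ is processed, it sees $n$ and the subgraph induced by the radius-$T(n)$ neighborhood of $v$, with its edge directions, identifiers and input labels, together with the states and outputs of the nodes in it that were processed before; from this it computes the output label of $v$ and an arbitrary state, which are recorded at $v$. The algorithm *solves* $\Pi$ over rooted forests of maximum degree at most $\Delta$ if, for every such forest, every input labeling, every assignment of identifiers and every processing order, the resulting output labeling is permissible. **Theorem.** Let $\Pi$ be an LCL problem with checking radius $r$ and degree constraint $\Delta$, and let $\mathcal A$ be a deterministic SLOCAL algorithm that solves $\Pi$ over rooted forests of maximum degree at most $\Delta$ with locality $T(n)=o(\log_\Delta n)$, where $n$ is the number of nodes. Then there are a constant $k$ (independent of $n$) and a deterministic SLOCAL algorithm $\mathcal B$ that solves $\Pi$ over rooted forests of maximum degree at most $\Delta$ with locality $k$, that is, with locality $O(1)$. -/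

import Mathlib

open Filter Asymptotics

noncomputable section

namespace LCLModel

/-! ### Directed graphs

Graphs are directed; distances and neighborhoods are taken in the underlying undirected graph. -/

/-- A simple graph has no self-loops. -/
def Loopless {V : Type} (G : Digraph V) : Prop := ∀ v, ¬ G.Adj v v

/-- The degree of `v`: the number of directed edges incident to `v` (for graphs without
self-loops). -/
def degree {V : Type} (G : Digraph V) (v : V) : ℕ :=
  {u | G.Adj u v}.ncard + {u | G.Adj v u}.ncard

/-- All degrees are at most `Δ`. -/
def MaxDegreeLE {V : Type} (G : Digraph V) (Δ : ℕ) : Prop := ∀ v, degree G v ≤ Δ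

/-- The number of edges on a shortest (not necessarily directed) path, `⊤` if there is none. -/
def dist {V : Type} (G : Digraph V) (u v : V) : ℕ∞ := G.toSimpleGraphInclusive.edist u v

/-- The radius-`T` neighborhood of `v`. -/
def ball {V : Type} (G : Digraph V) (T : ℕ) (v : V) : Set V := {w | dist G v w ≤ T}

/-- A rooted forest: a forest in which each edge has exactly one of the two orientations and
every node has outdegree at most one (edges point towards the roots). -/
structure IsRootedForest {V : Type} (G : Digraph V) : Prop where
  loopless : Loopless G
  oriented : ∀ u v, G.Adj u v → ¬ G.Adj v u
  outdegree_le_one : ∀ u v w, G.Adj u v → G.Adj u w → v = w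
  acyclic : G.toSimpleGraphInclusive.IsAcyclic

/-! ### Locally checkable labeling problems -/

/-- A labeling problem assigns to every input-labeled graph its set of permissible output
labelings, in an isomorphism-invariant way. -/
structure LabelingProblem (In Out : Type) where
  permissible : {V : Type} → Digraph V → (V → In) → Set (V → Out)
  iso_closed : ∀ {V W : Type} (G : Digraph V) (H : Digraph W) (φ : G.Adj ≃r H.Adj)
    (input : W → In) (out : W → Out),
    out ∈ permissible H input → out ∘ φ ∈ permissible G (input ∘ φ)

/-- A finite centered graph with input and output labels. -/
structure CenteredLabeledGraph (In Out : Type) where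
  V : Type
  finite : Finite V
  graph : Digraph V
  center : V
  input : V → In
  output : V → Out

/-- Isomorphism of centered labeled graphs. -/
def CenteredLabeledGraph.Isomorphic {In Out : Type} (H K : CenteredLabeledGraph In Out) : Prop :=
  ∃ φ : H.graph.Adj ≃r K.graph.Adj, φ H.center = K.center ∧
    (∀ v, K.input (φ v) = H.input v) ∧ (∀ v, K.output (φ v) = H.output v)

/-- The subgraph induced by the radius-`r` neighborhood of `v`, centered at `v`, with the
restrictions of the two labelings. -/
def localView {In Out V : Type} [Finite V] (G : Digraph V) (input : V → In) (out : V → Out)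
    (r : ℕ) (v : V) : CenteredLabeledGraph In Out where
  V := ball G r v
  finite := inferInstance
  graph := { Adj := fun a b => G.Adj a b }
  center := ⟨v, by simp [ball, dist]⟩
  input := fun w => input w
  output := fun w => out w

/-- `P` is locally checkable with checking radius `r` and degree constraint `Δ`: there is a
family `S` of admissible centered labeled graphs of radius at most `r` and maximum degree at most
`Δ`, such that on every finite simple graph of maximum degree at most `Δ` a labeling is
permissible iff all radius-`r` neighborhoods belong to `S` up to isomorphism. -/
def LabelingProblem.IsLocallyCheckable {In Out : Type} (P : LabelingProblem In Out)
    (r Δ : ℕ) : Prop :=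
  ∃ S : Set (CenteredLabeledGraph In Out),
    (∀ H ∈ S, Loopless H.graph ∧ MaxDegreeLE H.graph Δ ∧ ∀ w, dist H.graph H.center w ≤ r) ∧
    ∀ (V : Type) [Finite V] (G : Digraph V) (input : V → In) (out : V → Out),
      Loopless G → MaxDegreeLE G Δ →
      (out ∈ P.permissible G input ↔
        ∀ v, ∃ H ∈ S, (localView G input out r v).Isomorphic H)

/-! ### The deterministic SLOCAL model -/

/-- What an algorithm sees when a node is processed. Nodes are named by their unique identifiers.
`inputs` lists the visible nodes with their input labels, `edges` the directed edges between
visible nodes, and `memory` the states and outputs of the visible nodes processed before. -/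
structure View (In Out State : Type) where
  center : ℕ
  inputs : Set (ℕ × In)
  edges : Set (ℕ × ℕ)
  memory : Set (ℕ × State × Out)

/-- A deterministic SLOCAL algorithm: from the number `n` of nodes and the current view it
computes the state and the output to be recorded at the processed node. -/
structure SLOCALAlgorithm (In Out : Type) where
  State : Type
  step : ℕ → View In Out State → State × Out

/-- The view of `v` with radius `T`, given the records `mem` of the nodes processed so far. -/
def viewOf {In Out State V : Type} (G : Digraph V) (ident : V → ℕ) (input : V → In) (T : ℕ)
    (mem : V → Option (State × Out)) (v : V) : View In Out State where
  center := ident v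
  inputs := {p | ∃ w ∈ ball G T v, p = (ident w, input w)}
  edges := {p | ∃ u ∈ ball G T v, ∃ w ∈ ball G T v, G.Adj u w ∧ p = (ident u, ident w)}
  memory := {p | ∃ w ∈ ball G T v, ∃ s, mem w = some s ∧ p = (ident w, s)}

open Classical in
/-- Process the node `v` with locality `T`. -/
def SLOCALAlgorithm.process {In Out V : Type} (A : SLOCALAlgorithm In Out) (n T : ℕ)
    (G : Digraph V) (ident : V → ℕ) (input : V → In) (mem : V → Option (A.State × Out)) (v : V) :
    V → Option (A.State × Out) :=
  Function.update mem v (some (A.step n (viewOf G ident input T mem v)))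

/-- The records after processing the nodes one by one in the order given by a list. -/
def SLOCALAlgorithm.run {In Out V : Type} (A : SLOCALAlgorithm In Out) (n T : ℕ)
    (G : Digraph V) (ident : V → ℕ) (input : V → In) (order : List V) :
    V → Option (A.State × Out) :=
  order.foldl (A.process n T G ident input) (fun _ => none)

/-- `A` solves `P` with locality `T(n)` over rooted forests of maximum degree at most `Δ`, where
`n` is the number of nodes: its output is permissible for all input labelings, all assignments of
unique identifiers from `{1, …, n ^ c}` and all processing orders. -/
def SLOCALAlgorithm.Solves {In Out : Type} (A : SLOCALAlgorithm In Out)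
    (P : LabelingProblem In Out) (Δ c : ℕ) (T : ℕ → ℕ) : Prop :=
  ∀ (V : Type) [Finite V] (G : Digraph V), IsRootedForest G → MaxDegreeLE G Δ →
    ∀ (input : V → In) (ident : V → ℕ), Function.Injective ident →
      (∀ v, 1 ≤ ident v ∧ ident v ≤ Nat.card V ^ c) →
    ∀ order : List V, order.Nodup → (∀ v, v ∈ order) →
      ∃ out ∈ P.permissible G input, ∀ v,
        (A.run (Nat.card V) (T (Nat.card V)) G ident input order v).map Prod.snd = some (out v)

end LCLModel

end

/-!
Greedily color the nodes with `n` colors so that nodes within distance `O(T(n))` of each other get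
distinct colors; for a constant `n` with `(Δ + 1) ^ O(T(n)) ≤ n` this takes constant locality, as
each node that is processed colors its neighborhood and records the coloring. Such an `n` exists
because `T(n) = o(log n)`.

Around each node, the colors are then unique identifiers of a rooted forest with exactly `n`
nodes, and `A` could be run there with locality `T(n)`. Its processing order must be chosen
locally. Mark nodes greedily, by color, so that on every path towards the roots consecutive marks
are more than `2 T(n)` but only `O(T(n))` steps apart. The nodes with a mark at most `T(n)` steps
above them form one layer, the others a second one; each layer splits into clusters of diameter
`O(T(n))` that are more than `T(n)` apart. In the run of `A` that processes the first layer before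
the second, and each layer by increasing color, the output of a node depends only on its
neighborhood of radius `O(T(n))`. Hence around each node it agrees with the output of `A` on an
`n`-node forest, so it is locally correct. The marks, too, depend only on a neighborhood of
constant radius, because the number of colors is constant; so all this can be computed with
constant locality.
-/

noncomputable section

namespace LCLModel

section Balls

variable {V : Type} {G : Digraph V}

theorem mem_ball_iff {T : ℕ} {v w : V} :
    w ∈ ball G T v ↔ G.toSimpleGraphInclusive.edist v w ≤ T :=
  Iff.rfl

theorem mem_ball_self (T : ℕ) (v : V) : v ∈ ball G T v := by
  simp [mem_ball_iff]

theorem mem_ball_zero {v w : V} : w ∈ ball G 0 v ↔ w = v := by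
  rw [mem_ball_iff, Nat.cast_zero, nonpos_iff_eq_zero, SimpleGraph.edist_eq_zero_iff, eq_comm]

theorem mem_ball_symm {T : ℕ} {v w : V} (h : w ∈ ball G T v) : v ∈ ball G T w :=
  SimpleGraph.edist_comm.trans_le h

theorem mem_ball_trans {S T : ℕ} {u v w : V} (h : v ∈ ball G S u) (h' : w ∈ ball G T v) :
    w ∈ ball G (S + T) u :=
  SimpleGraph.edist_triangle.trans ((add_le_add h h').trans_eq (Nat.cast_add S T).symm)

theorem ball_mono {S T : ℕ} (h : S ≤ T) (v : V) : ball G S v ⊆ ball G T v :=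
  fun _ hw => (mem_ball_iff.1 hw).trans (Nat.cast_le.2 h)

theorem ball_subset_ball {S T : ℕ} {u v : V} (h : v ∈ ball G S u) :
    ball G T v ⊆ ball G (S + T) u :=
  fun _ hw => mem_ball_trans h hw

theorem mem_ball_one_of_adj {v w : V} (h : G.Adj v w ∨ G.Adj w v) : w ∈ ball G 1 v := by
  by_cases hvw : v = w
  · exact hvw ▸ mem_ball_self _ _
  · have hadj : G.toSimpleGraphInclusive.Adj v w := ⟨hvw, h⟩
    simpa [mem_ball_iff] using SimpleGraph.edist_le hadj.toWalk

theorem mem_ball_succ {T : ℕ} {v w : V} :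
    w ∈ ball G (T + 1) v ↔ w ∈ ball G T v ∨ ∃ u ∈ ball G T v, G.Adj u w ∨ G.Adj w u := by
  constructor
  · intro h
    obtain ⟨p, hp⟩ := SimpleGraph.exists_walk_of_edist_ne_top
      (ne_top_of_le_ne_top (ENat.natCast_ne_top (T + 1)) h)
    have hlength : p.length ≤ T + 1 := by exact_mod_cast hp.trans_le h
    by_cases hnil : p.Nil
    · exact Or.inl (hnil.eq ▸ mem_ball_self T v)
    · refine Or.inr ⟨p.penultimate, (SimpleGraph.edist_le p.dropLast).trans ?_,
        (p.adj_penultimate hnil).2⟩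
      rw [SimpleGraph.Walk.length_dropLast]
      exact_mod_cast Nat.sub_le_of_le_add hlength
  · rintro (h | ⟨u, hu, hadj⟩)
    · exact ball_mono (Nat.le_succ T) v h
    · exact mem_ball_trans hu (mem_ball_one_of_adj hadj)

theorem ncard_ball_le [Finite V] {Δ : ℕ} (hG : MaxDegreeLE G Δ) (T : ℕ) (v : V) :
    (ball G T v).ncard ≤ (Δ + 1) ^ T := by
  induction T with
  | zero => simp [show ball G 0 v = {v} from Set.ext fun _ => mem_ball_zero]
  | succ T ih =>
    have hfin := (ball G T v).toFinite
    have hsub : ball G (T + 1) v ⊆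
        ball G T v ∪ ⋃ u ∈ hfin.toFinset, ({w | G.Adj w u} ∪ {w | G.Adj u w}) := by
      intro w hw
      simp only [Set.mem_union, Set.mem_iUnion, Set.Finite.mem_toFinset]
      exact (mem_ball_succ.1 hw).imp_right fun ⟨u, hu, h⟩ => ⟨u, hu, h.symm⟩
    calc (ball G (T + 1) v).ncard
        ≤ (ball G T v).ncard +
          (⋃ u ∈ hfin.toFinset, ({w | G.Adj w u} ∪ {w | G.Adj u w})).ncard :=
          (Set.ncard_le_ncard hsub (Set.toFinite _)).trans (Set.ncard_union_le _ _)
      _ ≤ (ball G T v).ncard + ∑ _ ∈ hfin.toFinset, Δ := by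
          gcongr
          refine (Finset.set_ncard_biUnion_le _ _).trans (Finset.sum_le_sum fun _ _ => ?_)
          exact (Set.ncard_union_le _ _).trans (hG _)
      _ = (ball G T v).ncard * (Δ + 1) := by
          rw [Finset.sum_const, ← Set.ncard_eq_toFinset_card _ hfin, smul_eq_mul]
          ring
      _ ≤ (Δ + 1) ^ (T + 1) := by
          rw [pow_succ]
          gcongr

end Balls

section Images

variable {V W : Type} {G : Digraph V} {S : Set V} {e : V → W}

/-- The image under `e` of the subgraph of `G` induced by `S`; all nodes outside `e '' S` are
isolated. It is only meaningful when `e` is injective on `S`. -/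
def imageOn (G : Digraph V) (S : Set V) (e : V → W) : Digraph W where
  Adj x y := ∃ a ∈ S, ∃ b ∈ S, G.Adj a b ∧ e a = x ∧ e b = y

theorem imageOn_adj (he : Set.InjOn e S) {a b : V} (ha : a ∈ S) (hb : b ∈ S) :
    (imageOn G S e).Adj (e a) (e b) ↔ G.Adj a b := by
  constructor
  · rintro ⟨a', ha', b', hb', h, h1, h2⟩
    rwa [← he ha' ha h1, ← he hb' hb h2]
  · intro h
    exact ⟨a, ha, b, hb, h, rfl, rfl⟩

theorem ball_imageOn_subset (he : Set.InjOn e S) {a : V} (ha : a ∈ S) (T : ℕ) :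
    ball (imageOn G S e) T (e a) ⊆ e '' (ball G T a ∩ S) := by
  induction T with
  | zero =>
    intro w hw
    exact ⟨a, ⟨mem_ball_self _ _, ha⟩, (mem_ball_zero.1 hw).symm⟩
  | succ T ih =>
    intro w hw
    rcases mem_ball_succ.1 hw with h | ⟨u, hu, h⟩
    · obtain ⟨b, ⟨hb, hbS⟩, rfl⟩ := ih h
      exact ⟨b, ⟨ball_mono (Nat.le_succ T) a hb, hbS⟩, rfl⟩
    · obtain ⟨b, ⟨hb, hbS⟩, rfl⟩ := ih hu
      rcases h with ⟨b', hb', d, hd, hadj, h1, rfl⟩ | ⟨d, hd, b', hb', hadj, rfl, h1⟩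
      · obtain rfl := he hb' hbS h1
        exact ⟨d, ⟨mem_ball_succ.2 (Or.inr ⟨b', hb, Or.inl hadj⟩), hd⟩, rfl⟩
      · obtain rfl := he hb' hbS h1
        exact ⟨d, ⟨mem_ball_succ.2 (Or.inr ⟨b', hb, Or.inr hadj⟩), hd⟩, rfl⟩

theorem map_mem_ball_imageOn {a b : V} {T : ℕ} (hS : ball G T a ⊆ S) (hb : b ∈ ball G T a) :
    e b ∈ ball (imageOn G S e) T (e a) := by
  induction T generalizing b with
  | zero =>
    obtain rfl := mem_ball_zero.1 hb
    exact mem_ball_self _ _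
  | succ T ih =>
    have hS' : ball G T a ⊆ S := (ball_mono (Nat.le_succ T) a).trans hS
    rcases mem_ball_succ.1 hb with h | ⟨u, hu, h⟩
    · exact ball_mono (Nat.le_succ T) _ (ih hS' h)
    · refine mem_ball_succ.2 (Or.inr ⟨e u, ih hS' hu, ?_⟩)
      exact h.imp (fun h => ⟨u, hS' hu, b, hS hb, h, rfl, rfl⟩)
        (fun h => ⟨b, hS hb, u, hS' hu, h, rfl, rfl⟩)

theorem ball_imageOn (he : Set.InjOn e S) {a : V} {T : ℕ} (hS : ball G T a ⊆ S) :
    ball (imageOn G S e) T (e a) = e '' ball G T a := by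
  refine Set.Subset.antisymm ?_ (Set.image_subset_iff.2 fun b hb => map_mem_ball_imageOn hS hb)
  exact (ball_imageOn_subset he (hS (mem_ball_self _ _)) T).trans
    (Set.image_mono Set.inter_subset_left)

theorem maxDegreeLE_imageOn [Finite V] (he : Set.InjOn e S) {Δ : ℕ} (hG : MaxDegreeLE G Δ) :
    MaxDegreeLE (imageOn G S e) Δ := by
  intro x
  by_cases hx : x ∈ e '' S
  · obtain ⟨a, ha, rfl⟩ := hx
    have hpred : {u | (imageOn G S e).Adj u (e a)} ⊆ e '' {u | G.Adj u a} := by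
      rintro _ ⟨u, _, a', ha', h, rfl, h2⟩
      exact ⟨u, he ha' ha h2 ▸ h, rfl⟩
    have hsucc : {u | (imageOn G S e).Adj (e a) u} ⊆ e '' {u | G.Adj a u} := by
      rintro _ ⟨a', ha', u, _, h, h2, rfl⟩
      exact ⟨u, he ha' ha h2 ▸ h, rfl⟩
    have ncard_le {X : Set W} {Y : Set V} (h : X ⊆ e '' Y) : X.ncard ≤ Y.ncard :=
      (Set.ncard_le_ncard h (Set.toFinite _)).trans (Set.ncard_image_le (Set.toFinite _))
    exact (Nat.add_le_add (ncard_le hpred) (ncard_le hsucc)).trans (hG a)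
  · have hpred : {u | (imageOn G S e).Adj u x} = ∅ :=
      Set.eq_empty_of_forall_notMem fun _ ⟨_, _, b, hb, _, _, h⟩ => hx ⟨b, hb, h⟩
    have hsucc : {u | (imageOn G S e).Adj x u} = ∅ :=
      Set.eq_empty_of_forall_notMem fun _ ⟨b, hb, _, _, _, h, _⟩ => hx ⟨b, hb, h⟩
    simp [degree, hpred, hsucc]

theorem isAcyclic_imageOn (he : Set.InjOn e S) (hG : G.toSimpleGraphInclusive.IsAcyclic) :
    (imageOn G S e).toSimpleGraphInclusive.IsAcyclic := by
  rw [SimpleGraph.isAcyclic_iff_forall_adj_isBridge] at hG ⊢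
  have exists_preimage : ∀ x y, (imageOn G S e).toSimpleGraphInclusive.Adj x y →
      ∃ a ∈ S, ∃ b ∈ S, e a = x ∧ e b = y ∧ G.toSimpleGraphInclusive.Adj a b := by
    rintro x y ⟨hne, ⟨a, ha, b, hb, h, rfl, rfl⟩ | ⟨b, hb, a, ha, h, rfl, rfl⟩⟩
    · exact ⟨a, ha, b, hb, rfl, rfl, fun h => hne (congrArg e h), Or.inl h⟩
    · exact ⟨a, ha, b, hb, rfl, rfl, fun h => hne (congrArg e h), Or.inr h⟩
  intro x y hxy
  obtain ⟨a, ha, b, hb, rfl, rfl, hab⟩ := exists_preimage x y hxy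
  have : Nonempty V := ⟨a⟩
  have hinv : ∀ a ∈ S, Function.invFunOn e S (e a) = a := he.leftInvOn_invFunOn
  have adj_inv : ∀ x y, ((imageOn G S e).toSimpleGraphInclusive.deleteEdges {s(e a, e b)}).Adj x y →
      (G.toSimpleGraphInclusive.deleteEdges {s(a, b)}).Adj
        (Function.invFunOn e S x) (Function.invFunOn e S y) := by
    intro x y hxy
    rw [SimpleGraph.deleteEdges_adj] at hxy ⊢
    obtain ⟨a', ha', b', hb', rfl, rfl, hab'⟩ := exists_preimage x y hxy.1
    rw [hinv a' ha', hinv b' hb']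
    exact ⟨hab', fun hmem => hxy.2 (by simpa using congrArg (Sym2.map e) hmem)⟩
  have hbridge := hG hab
  rw [SimpleGraph.isBridge_iff] at hbridge ⊢
  intro hreach
  apply hbridge
  simpa [hinv a ha, hinv b hb] using hreach.map
    (⟨_, fun {x y} h => adj_inv x y h⟩ :
      (imageOn G S e).toSimpleGraphInclusive.deleteEdges {s(e a, e b)} →g
        G.toSimpleGraphInclusive.deleteEdges {s(a, b)})

theorem isRootedForest_imageOn (he : Set.InjOn e S) (hG : IsRootedForest G) :
    IsRootedForest (imageOn G S e) where
  loopless := by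
    rintro _ ⟨a, ha, b, hb, h, rfl, h2⟩
    obtain rfl := he hb ha h2
    exact hG.loopless _ h
  oriented := by
    rintro _ _ ⟨a, ha, b, hb, h, rfl, rfl⟩ h'
    exact hG.oriented _ _ h ((imageOn_adj he hb ha).1 h')
  outdegree_le_one := by
    rintro _ _ _ ⟨a, ha, b, _, h, rfl, rfl⟩ ⟨a', ha', d, _, h', h1, rfl⟩
    obtain rfl := he ha' ha h1
    rw [hG.outdegree_le_one _ _ _ h h']
  acyclic := isAcyclic_imageOn he hG.acyclic

end Images

section Ancestors

variable {V : Type} {G : Digraph V}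

open Classical in
/-- The parent map of a rooted forest in which an infinite directed path is attached to each root:
`(v, 0)` is the node `v`, and `(v, 1), (v, 2), …` are the further nodes above a root `v`. -/
def up (G : Digraph V) (x : V × ℕ) : V × ℕ :=
  if h : x.2 = 0 ∧ ∃ p, G.Adj x.1 p then (h.2.choose, 0) else (x.1, x.2 + 1)

theorem up_of_adj (hG : IsRootedForest G) {v p : V} (h : G.Adj v p) : up G (v, 0) = (p, 0) := by
  have h' : (v, 0).2 = 0 ∧ ∃ p, G.Adj (v, 0).1 p := ⟨rfl, p, h⟩
  rw [up, dif_pos h', hG.outdegree_le_one _ _ _ h'.2.choose_spec h]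

theorem up_of_root {v : V} (h : ∀ p, ¬ G.Adj v p) : up G (v, 0) = (v, 1) := by
  rw [up, dif_neg fun ⟨_, p, hp⟩ => h p hp]

theorem up_succ (v : V) (j : ℕ) : up G (v, j + 1) = (v, j + 2) := by
  rw [up, dif_neg fun h => Nat.succ_ne_zero j h.1]

theorem iterate_up_succ (v : V) (j i : ℕ) : (up G)^[i] (v, j + 1) = (v, j + i + 1) := by
  induction i with
  | zero => rfl
  | succ i ih => rw [Function.iterate_succ_apply', ih, up_succ]; rfl

theorem up_fst_mem_ball (x : V × ℕ) : (up G x).1 ∈ ball G 1 x.1 := by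
  rw [up]
  split_ifs with h
  · exact mem_ball_one_of_adj (Or.inl h.2.choose_spec)
  · exact mem_ball_self _ _

theorem iterate_up_fst_mem_ball (x : V × ℕ) (i : ℕ) : ((up G)^[i] x).1 ∈ ball G i x.1 := by
  induction i with
  | zero => exact mem_ball_self _ _
  | succ i ih =>
    rw [Function.iterate_succ_apply']
    exact mem_ball_trans ih (up_fst_mem_ball _)

theorem mem_ball_of_iterate_up_eq {u w : V} {a b : ℕ}
    (h : (up G)^[a] (u, 0) = (up G)^[b] (w, 0)) : w ∈ ball G (a + b) u :=
  mem_ball_trans (h ▸ iterate_up_fst_mem_ball (G := G) (u, 0) a)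
    (mem_ball_symm (iterate_up_fst_mem_ball (w, 0) b))

theorem exists_iterate_up_eq (hG : IsRootedForest G) {T : ℕ} {u w : V} (h : w ∈ ball G T u) :
    ∃ a b, a + b ≤ T ∧ (up G)^[a] (u, 0) = (up G)^[b] (w, 0) := by
  induction T generalizing w with
  | zero => exact ⟨0, 0, le_rfl, by rw [mem_ball_zero.1 h]⟩
  | succ T ih =>
    rcases mem_ball_succ.1 h with h | ⟨x, hx, h⟩
    · obtain ⟨a, b, hab, h⟩ := ih h
      exact ⟨a, b, Nat.le_succ_of_le hab, h⟩
    obtain ⟨a, b, hab, hx⟩ := ih hx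
    rcases h with hparent | hchild
    · cases b with
      | zero =>
        refine ⟨a + 1, 0, by lia, ?_⟩
        rw [Function.iterate_succ_apply', hx]
        exact up_of_adj hG hparent
      | succ b =>
        refine ⟨a, b, by lia, ?_⟩
        rw [hx, Function.iterate_succ_apply, up_of_adj hG hparent]
    · refine ⟨a, b + 1, by lia, ?_⟩
      rw [hx, Function.iterate_succ_apply, up_of_adj hG hchild]

theorem exists_directed_walk_of_iterate_up_eq (hG : IsRootedForest G) {i : ℕ} {v w : V}
    (h : (up G)^[i] (v, 0) = (w, 0)) :
    ∃ p : G.toSimpleGraphInclusive.Walk v w,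
      p.length = i ∧ ∀ d ∈ p.darts, G.Adj d.fst d.snd := by
  induction i generalizing v with
  | zero =>
    obtain rfl : v = w := congrArg Prod.fst h
    exact ⟨.nil, rfl, by simp⟩
  | succ i ih =>
    rw [Function.iterate_succ_apply] at h
    by_cases hroot : ∃ p, G.Adj v p
    · obtain ⟨p, hvp⟩ := hroot
      rw [up_of_adj hG hvp] at h
      obtain ⟨q, rfl, hq⟩ := ih h
      have hadj : G.toSimpleGraphInclusive.Adj v p :=
        ⟨fun hloop => hG.loopless v (hloop.symm ▸ hvp), Or.inl hvp⟩
      exact ⟨.cons hadj q, rfl, by simpa using ⟨hvp, hq⟩⟩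
    · rw [up_of_root (not_exists.1 hroot), iterate_up_succ] at h
      simp at h

theorem IsRootedForest.isPath_of_directed (hG : IsRootedForest G) {v w : V}
    {p : G.toSimpleGraphInclusive.Walk v w} (hp : ∀ d ∈ p.darts, G.Adj d.fst d.snd) :
    p.IsPath := by
  rw [hG.acyclic.isPath_iff_isChain, SimpleGraph.Walk.edges, List.isChain_map]
  refine p.isChain_dartAdj_darts.imp_of_mem_imp fun d d' hd hd' hdd' heq => ?_
  rcases SimpleGraph.dart_edge_eq_iff d d' |>.1 heq with rfl | rfl
  · exact d.adj.ne hdd'.symm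
  · exact hG.oriented _ _ (hp _ hd') (hp _ hd)

theorem iterate_up_ne (hG : IsRootedForest G) (v : V) {i : ℕ} (hi : i ≠ 0) :
    (up G)^[i] (v, 0) ≠ (v, 0) := by
  intro hperiodic
  obtain ⟨p, rfl, hp⟩ := exists_directed_walk_of_iterate_up_eq hG hperiodic
  have hnil := SimpleGraph.Walk.isPath_iff_nil.1 (hG.isPath_of_directed hp)
  exact hi (SimpleGraph.Walk.length_eq_zero_iff.2 hnil)

theorem iterate_up_imageOn {W : Type} {S : Set V} {e : V → W} (hG : IsRootedForest G)
    (he : Set.InjOn e S) {v : V} {i : ℕ} (hS : ball G i v ⊆ S) :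
    (up (imageOn G S e))^[i] (e v, 0) = Prod.map e id ((up G)^[i] (v, 0)) := by
  induction i with
  | zero => rfl
  | succ i ih =>
    rw [Function.iterate_succ_apply', Function.iterate_succ_apply',
      ih ((ball_mono (Nat.le_succ i) v).trans hS)]
    have hmem := iterate_up_fst_mem_ball (G := G) (v, 0) i
    obtain ⟨⟨w, _ | j⟩, hx⟩ : ∃ x, (up G)^[i] (v, 0) = x := ⟨_, rfl⟩ <;> rw [hx] at hmem ⊢
    · have hw : w ∈ S := hS (ball_mono (Nat.le_succ i) v hmem)
      by_cases hroot : ∃ p, G.Adj w p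
      · obtain ⟨p, hp⟩ := hroot
        have hpS : p ∈ S := hS (mem_ball_trans hmem (mem_ball_one_of_adj (Or.inl hp)))
        rw [up_of_adj hG hp]
        exact up_of_adj (isRootedForest_imageOn he hG) ((imageOn_adj he hw hpS).2 hp)
      · rw [up_of_root (not_exists.1 hroot)]
        refine up_of_root ?_
        rintro _ ⟨a, ha, b, _, hab, h1, rfl⟩
        obtain rfl := he ha hw h1
        exact hroot ⟨b, hab⟩
    · simp only [Prod.map_apply, id_eq, up_succ]

end Ancestors

section GreedyMarks

/-- The greedy maximal set of natural numbers with gaps at least `h`, where `i` is considered at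
time `s i`: it contains `i` unless it contains a number at distance less than `h` that was
considered before. -/
def GreedilyChosen (h : ℕ) (s : ℕ → ℕ) (i : ℕ) : Prop :=
  ∀ j, i < j + h → j < i + h → s j < s i → ¬ GreedilyChosen h s j
termination_by s i

-- Along a chain of decisions the times decrease, so a choice depends on a bounded window only.
theorem greedilyChosen_add_iff {h t : ℕ} {s s' : ℕ → ℕ} {i : ℕ} (hi : h * s' i ≤ i)
    (hs : ∀ j ≤ i + h * s' i, s (t + j) = s' j) :
    GreedilyChosen h s (t + i) ↔ GreedilyChosen h s' i := by
  induction hn : s' i using Nat.strong_induction_on generalizing i with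
  | _ n ih =>
    have hsi : s (t + i) = s' i := hs i (by lia)
    have hnear : ∀ j, i < j + h → j < i + h → s' j < s' i →
        (GreedilyChosen h s (t + j) ↔ GreedilyChosen h s' j) := by
      intro j h1 h2 h3
      have hmul : h * s' j + h ≤ h * s' i := (Nat.mul_succ h _).ge.trans (Nat.mul_le_mul_left h h3)
      exact ih (s' j) (hn ▸ h3) (by lia) (fun l hl => hs l (by lia)) rfl
    rw [GreedilyChosen, GreedilyChosen]
    constructor
    · intro hchosen j h1 h2 h3
      rw [← hnear j h1 h2 h3]
      have hpos : h ≤ h * s' i := Nat.le_mul_of_pos_right h (by lia)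
      exact hchosen (t + j) (by lia) (by lia) (by rwa [hsi, hs j (by lia)])
    · intro hchosen j h1 h2 h3
      have hpos : h ≤ h * s' i := Nat.le_mul_of_pos_right h (by lia)
      obtain ⟨j, rfl⟩ : ∃ l, j = t + l := ⟨j - t, by lia⟩
      rw [hsi, hs j (by lia)] at h3
      rw [hnear j (by lia) (by lia) h3]
      exact hchosen j (by lia) (by lia) h3

theorem GreedilyChosen.add_le {h : ℕ} {s : ℕ → ℕ} (hs : ∀ i j, i < j → j < i + h → s i ≠ s j)
    {i j : ℕ} (hi : GreedilyChosen h s i) (hj : GreedilyChosen h s j) (hij : i < j) :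
    i + h ≤ j := by
  by_contra! hlt
  have hi' := hi
  have hj' := hj
  rw [GreedilyChosen] at hi' hj'
  rcases (hs i j hij hlt).lt_or_gt with h' | h'
  · exact hj' i (by lia) (by lia) h' hi
  · exact hi' j (by lia) (by lia) h' hj

theorem exists_greedilyChosen {h : ℕ} (hh : h ≠ 0) (s : ℕ → ℕ) (i : ℕ) :
    ∃ j, i < j + h ∧ j < i + h ∧ GreedilyChosen h s j := by
  by_cases hi : GreedilyChosen h s i
  · exact ⟨i, by lia, by lia, hi⟩
  · rw [GreedilyChosen] at hi
    push Not at hi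
    obtain ⟨j, h1, h2, -, h3⟩ := hi
    exact ⟨j, h1, h2, h3⟩

variable {X Y : Type*} {f : X → X} {κ : X → ℕ} {h B : ℕ}

/-- A coloring with colors at most `B` in which any `h` consecutive points of an orbit of `f` have
distinct colors. -/
structure IsOrbitColoring (f : X → X) (κ : X → ℕ) (h B : ℕ) : Prop where
  le : ∀ x, κ x ≤ B
  ne : ∀ x i, i ≠ 0 → i < h → κ (f^[i] x) ≠ κ x

/-- A set that meets each orbit of `f` in a greedy set with gaps at least `h`, considering points
in the order of their colors `κ`. If the colors are at most `B`, then whether the `h * B`-th point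
of an orbit is chosen cannot depend on where the orbit starts, so this point decides for `x`. -/
def Marked (f : X → X) (κ : X → ℕ) (h B : ℕ) (x : X) : Prop :=
  GreedilyChosen h (fun i => κ (f^[i] x)) (h * B)

theorem marked_congr {g : Y → Y} {lam : Y → ℕ} {x : X} {y : Y} (hκ : ∀ x, κ x ≤ B)
    (heq : ∀ i ≤ 2 * (h * B), lam (g^[i] y) = κ (f^[i] x)) :
    Marked g lam h B y ↔ Marked f κ h B x := by
  have hle : h * κ (f^[h * B] x) ≤ h * B := Nat.mul_le_mul_left h (hκ _)
  have := greedilyChosen_add_iff (t := 0) (s := fun i => lam (g^[i] y))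
    (s' := fun i => κ (f^[i] x)) (i := h * B) hle
    fun j hj => by simpa only [Nat.zero_add] using heq j (by lia)
  rwa [Nat.zero_add] at this

theorem marked_iterate (hκ : ∀ x, κ x ≤ B) (x : X) (t : ℕ) :
    Marked f κ h B (f^[t] x) ↔ GreedilyChosen h (fun i => κ (f^[i] x)) (t + h * B) :=
  (greedilyChosen_add_iff (s := fun i => κ (f^[i] x)) (Nat.mul_le_mul_left h (hκ _))
    fun j _ => by rw [add_comm, Function.iterate_add_apply]).symm

theorem exists_marked_iterate (hκ : ∀ x, κ x ≤ B) (x : X) (t : ℕ) :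
    ∃ i, t ≤ i ∧ i ≤ t + 2 * h ∧ Marked f κ (h + 1) B (f^[i] x) := by
  obtain ⟨j, h1, h2, h3⟩ := exists_greedilyChosen h.succ_ne_zero (fun i => κ (f^[i] x))
    (t + h + (h + 1) * B)
  refine ⟨j - (h + 1) * B, by lia, by lia, ?_⟩
  rwa [marked_iterate hκ, Nat.sub_add_cancel (by lia)]

theorem IsOrbitColoring.not_marked_iterate (hκ : IsOrbitColoring f κ h B) {x : X}
    (hx : Marked f κ h B x) {i : ℕ} (hi : i ≠ 0) (hlt : i < h) : ¬ Marked f κ h B (f^[i] x) := by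
  intro hix
  rw [marked_iterate hκ.le] at hix
  have hgap : ∀ j k, j < k → k < j + h → κ (f^[j] x) ≠ κ (f^[k] x) := by
    intro j k hjk hlt
    have := hκ.ne (f^[j] x) (k - j) (by lia) (by lia)
    rw [← Function.iterate_add_apply, Nat.sub_add_cancel hjk.le] at this
    exact this.symm
  have := GreedilyChosen.add_le hgap hx hix (by lia)
  lia

end GreedyMarks

section Anchors

variable {X : Type*} {f : X → X} {p : X → Prop} {T : ℕ}

/-- One of the first `T + 1` points of the orbit of `x` under `f` satisfies `p`. -/
def IsNear (f : X → X) (p : X → Prop) (T : ℕ) (x : X) : Prop :=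
  ∃ i ≤ T, p (f^[i] x)

/-- The number of steps from `x` to the first point of its orbit that satisfies `p` and is more than
`T` steps away (`0` if there is none). -/
def anchorHeight (f : X → X) (p : X → Prop) (T : ℕ) (x : X) : ℕ :=
  sInf {i | T < i ∧ p (f^[i] x)}

/-- The point of an orbit that represents the cluster of `x`. -/
def anchor (f : X → X) (p : X → Prop) (T : ℕ) (x : X) : X :=
  f^[anchorHeight f p T x] x

theorem anchorHeight_spec (hex : ∀ x, ∃ i, T < i ∧ p (f^[i] x)) (x : X) :
    T < anchorHeight f p T x ∧ p (f^[anchorHeight f p T x] x) :=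
  Nat.sInf_mem (hex x)

theorem anchorHeight_le {x : X} {i : ℕ} (hi : T < i) (hp : p (f^[i] x)) :
    anchorHeight f p T x ≤ i :=
  Nat.sInf_le ⟨hi, hp⟩

theorem anchorHeight_add_le (hgap : ∀ x, p x → ∀ i ≠ 0, i ≤ 2 * T → ¬ p (f^[i] x))
    (hex : ∀ x, ∃ i, T < i ∧ p (f^[i] x)) {u w : X} {a b : ℕ} (hab : a + b ≤ T)
    (heq : f^[a] u = f^[b] w) (hnear : IsNear f p T u → IsNear f p T w) :
    anchorHeight f p T u + b ≤ anchorHeight f p T w + a := by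
  obtain ⟨hlt, hp⟩ := anchorHeight_spec hex w
  generalize anchorHeight f p T w = k at hlt hp ⊢
  have hk : f^[k - b + a] u = f^[k] w := by
    rw [Function.iterate_add_apply, heq, ← Function.iterate_add_apply, Nat.sub_add_cancel (by lia)]
  rcases lt_or_ge T (k - b + a) with hfar | hclose
  · have := anchorHeight_le hfar (hk ▸ hp)
    lia
  · obtain ⟨j, hj, hpj⟩ := hnear ⟨k - b + a, hclose, hk ▸ hp⟩
    have hjk : f^[k - j] (f^[j] w) = f^[k] w := by
      rw [← Function.iterate_add_apply, Nat.sub_add_cancel (by lia)]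
    exact absurd (hjk ▸ hp) (hgap _ hpj (k - j) (by lia) (by lia))

-- The `p`-point that is the anchor of `u` can only fail to be the anchor of `w` if it is at most
-- `T` steps away from `w`.
theorem anchor_eq_anchor (hgap : ∀ x, p x → ∀ i ≠ 0, i ≤ 2 * T → ¬ p (f^[i] x))
    (hex : ∀ x, ∃ i, T < i ∧ p (f^[i] x)) {u w : X} {a b : ℕ} (hab : a + b ≤ T)
    (heq : f^[a] u = f^[b] w) (hnear : IsNear f p T u ↔ IsNear f p T w) :
    anchor f p T u = anchor f p T w := by
  have h1 := anchorHeight_add_le hgap hex hab heq hnear.1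
  have h2 := anchorHeight_add_le hgap hex ((add_comm b a).trans_le hab) heq.symm hnear.2
  have hu := (anchorHeight_spec hex u).1
  rw [anchor, anchor, ← Nat.sub_add_cancel (show a ≤ anchorHeight f p T u by lia),
    Function.iterate_add_apply, heq, ← Function.iterate_add_apply]
  congr 2
  lia

end Anchors

section Colorings

variable {V : Type} {G : Digraph V} {M D : ℕ} {χ : V → ℕ}

/-- A partial coloring with colors `1, …, M` in which distinct colored nodes within distance `D` of
each other have distinct colors. The value `0` means that a node is uncolored. -/
structure IsPartialColoring (G : Digraph V) (M D : ℕ) (χ : V → ℕ) : Prop where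
  le : ∀ v, χ v ≤ M
  ne : ∀ v w, w ∈ ball G D v → v ≠ w → χ v ≠ 0 → χ v ≠ χ w

/-- A coloring of all nodes with colors `1, …, M` in which distinct nodes within distance `D` of
each other have distinct colors. -/
structure IsDistColoring (G : Digraph V) (M D : ℕ) (χ : V → ℕ) : Prop
    extends IsPartialColoring G M D χ where
  ne_zero : ∀ v, χ v ≠ 0

theorem IsDistColoring.injOn_ball (hχ : IsDistColoring G M D χ) {R : ℕ} (hR : 2 * R ≤ D) (v : V) :
    Set.InjOn χ (ball G R v) := by
  intro u hu w hw heq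
  by_contra hne
  have hw' : w ∈ ball G (R + R) u := mem_ball_trans (mem_ball_symm hu) hw
  exact hχ.ne u w (ball_mono (by lia) u hw') hne (hχ.ne_zero u) heq

theorem IsPartialColoring.of_eqOn_compl (hχ : IsPartialColoring G M D χ) {χ' : V → ℕ} {F : Set V}
    (heq : ∀ v ∉ F, χ' v = χ v) (hle : ∀ v ∈ F, χ' v ≤ M)
    (hne : ∀ v ∈ F, ∀ w ∈ ball G D v, v ≠ w → χ' v ≠ 0 → χ' v ≠ χ' w) :
    IsPartialColoring G M D χ' where
  le v := by
    by_cases hv : v ∈ F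
    · exact hle v hv
    · exact heq v hv ▸ hχ.le v
  ne v w hw hvw hv0 hcol := by
    by_cases hv : v ∈ F
    · exact hne v hv w hw hvw hv0 hcol
    by_cases hwF : w ∈ F
    · exact hne w hwF v (mem_ball_symm hw) hvw.symm (hcol ▸ hv0) hcol.symm
    · rw [heq v hv] at hcol hv0
      exact hχ.ne v w hw hvw hv0 (hcol.trans (heq w hwF))

theorem exists_unused_color [Finite V] {v : V} (hball : (ball G D v).ncard ≤ M) (χ : V → ℕ)
    (hv : χ v = 0) : ∃ c ≤ M, c ≠ 0 ∧ ∀ w ∈ ball G D v, χ w ≠ c := by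
  by_contra! hused
  have hsub : Set.Icc 1 M ⊆ χ '' (ball G D v \ {v}) := fun c hc => by
    obtain ⟨w, hw, rfl⟩ := hused c hc.2 (Nat.one_le_iff_ne_zero.1 hc.1)
    exact ⟨w, ⟨hw, fun h => Nat.one_le_iff_ne_zero.1 hc.1 (h ▸ hv)⟩, rfl⟩
  have hcard : M ≤ (ball G D v \ {v}).ncard := by
    simpa [Set.ncard_eq_toFinset_card'] using
      (Set.ncard_le_ncard hsub (Set.toFinite _)).trans (Set.ncard_image_le (Set.toFinite _))
  have := Set.ncard_sdiff_singleton_lt_of_mem (mem_ball_self (G := G) D v) (Set.toFinite _)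
  lia

theorem IsPartialColoring.exists_extension [Finite V] (hball : ∀ v, (ball G D v).ncard ≤ M)
    (hχ : IsPartialColoring G M D χ) (F : Set V) :
    ∃ χ', IsPartialColoring G M D χ' ∧ (∀ v, χ v ≠ 0 → χ' v = χ v) ∧
      ∀ v, χ' v ≠ 0 ↔ χ v ≠ 0 ∨ v ∈ F := by
  classical
  induction F, Set.toFinite F using Set.Finite.induction_on with
  | empty => exact ⟨χ, hχ, fun _ _ => rfl, by simp⟩
  | @insert a F _ _ ih =>
    obtain ⟨χ', hχ', hext, hdom⟩ := ih
    by_cases ha : χ' a = 0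
    · obtain ⟨c, hcM, hc0, hc⟩ := exists_unused_color (hball a) χ' ha
      refine ⟨Function.update χ' a c, hχ'.of_eqOn_compl (F := {a}) ?_ ?_ ?_, ?_, ?_⟩
      · exact fun v hv => Function.update_of_ne hv _ _
      · rintro _ rfl
        simpa using hcM
      · rintro _ rfl w hw hne -
        rw [Function.update_self, Function.update_of_ne hne.symm]
        exact (hc w hw).symm
      · intro v hv
        rw [Function.update_of_ne (by grind), hext v hv]
      · intro v
        have := hdom v
        grind
    · exact ⟨χ', hχ', hext, fun v => by grind⟩

end Colorings

section Layers

variable {V W : Type} {G : Digraph V} {M T D : ℕ} {χ : V → ℕ}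

/-- The extension of the coloring `χ` to the paths attached to the roots, which are colored
periodically with the colors `M + 1, …, M + h`. -/
def extColor (M h : ℕ) (χ : V → ℕ) : V × ℕ → ℕ
  | (v, 0) => χ v
  | (_, j + 1) => M + 1 + j % h

theorem extColor_le {h : ℕ} (hh : h ≠ 0) (hχ : ∀ v, χ v ≤ M) (x : V × ℕ) :
    extColor M h χ x ≤ M + h := by
  rcases x with ⟨v, _ | j⟩
  · exact (hχ v).trans (Nat.le_add_right M h)
  · have := Nat.mod_lt j (Nat.pos_of_ne_zero hh)
    simp only [extColor]
    lia

theorem isOrbitColoring_extColor (hG : IsRootedForest G) {h : ℕ} (hh : h ≠ 0) (hD : h ≤ D + 1)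
    (hχ : IsDistColoring G M D χ) : IsOrbitColoring (up G) (extColor M h χ) h (M + h) where
  le := extColor_le hh hχ.le
  ne := by
    rintro ⟨v, _ | j⟩ i hi0 hih
    · have hne := iterate_up_ne hG v hi0
      have hmem := iterate_up_fst_mem_ball (G := G) (v, 0) i
      obtain ⟨⟨w, _ | j⟩, hw⟩ : ∃ x, (up G)^[i] (v, 0) = x := ⟨_, rfl⟩ <;> rw [hw] at hmem hne ⊢
      · exact (hχ.ne v w (ball_mono (by lia) v hmem) (by grind) (hχ.ne_zero v)).symm
      · have := hχ.le v
        simp only [extColor]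
        lia
    · rw [iterate_up_succ]
      simp only [extColor]
      intro heq
      have hmod : j ≡ j + i [MOD h] := (Nat.add_left_cancel heq).symm
      have hdvd := (Nat.modEq_iff_dvd' (Nat.le_add_right j i)).1 hmod
      rw [Nat.add_sub_cancel_left] at hdvd
      exact absurd (Nat.le_of_dvd (Nat.pos_of_ne_zero hi0) hdvd) (by lia)

/-- The marks that split a rooted forest into layers: on every path towards the roots, consecutive
marks are more than `2 * T` and at most `4 * T + 1` steps apart. -/
def IsMark (G : Digraph V) (M T : ℕ) (χ : V → ℕ) : V × ℕ → Prop :=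
  Marked (up G) (extColor M (2 * T + 1) χ) (2 * T + 1) (M + (2 * T + 1))

open Classical in
/-- Layer `0` consists of the nodes with a mark at most `T` steps above them, layer `1` of the
others. -/
def layer (G : Digraph V) (M T : ℕ) (χ : V → ℕ) (v : V) : ℕ :=
  if IsNear (up G) (IsMark G M T χ) T (v, 0) then 0 else 1

/-- The layer of a node is determined by its neighborhood of this radius. -/
def layerRadius (M T : ℕ) : ℕ := T + 2 * ((2 * T + 1) * (M + (2 * T + 1)))

theorem layer_le_one (G : Digraph V) (M T : ℕ) (χ : V → ℕ) (v : V) : layer G M T χ v ≤ 1 := by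
  rw [layer]
  split_ifs <;> simp

theorem layer_eq_layer_iff {u v : V} : layer G M T χ u = layer G M T χ v ↔
    (IsNear (up G) (IsMark G M T χ) T (u, 0) ↔ IsNear (up G) (IsMark G M T χ) T (v, 0)) := by
  unfold layer
  split_ifs <;> simp [*]

theorem layer_imageOn (hG : IsRootedForest G) {S : Set V} {e : V → W} (he : Set.InjOn e S) {v : V}
    (hS : ball G (layerRadius M T) v ⊆ S) (hχ : ∀ v, χ v ≤ M) {χ' : W → ℕ}
    (heq : Set.EqOn (χ' ∘ e) χ (ball G (layerRadius M T) v)) :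
    layer (imageOn G S e) M T χ' (e v) = layer G M T χ v := by
  have hmark : ∀ i ≤ T, IsMark (imageOn G S e) M T χ' ((up (imageOn G S e))^[i] (e v, 0)) ↔
      IsMark G M T χ ((up G)^[i] (v, 0)) := by
    refine fun i hi => marked_congr (extColor_le (Nat.succ_ne_zero _) hχ) fun j hj => ?_
    have hij : j + i ≤ layerRadius M T := by
      rw [layerRadius]
      lia
    rw [← Function.iterate_add_apply, ← Function.iterate_add_apply,
      iterate_up_imageOn hG he ((ball_mono hij v).trans hS)]
    have hmem := ball_mono hij v (iterate_up_fst_mem_ball (G := G) (v, 0) (j + i))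
    obtain ⟨⟨w, _ | l⟩, hw⟩ : ∃ x, (up G)^[j + i] (v, 0) = x := ⟨_, rfl⟩ <;> rw [hw] at hmem ⊢
    · exact heq hmem
    · rfl
  have hnear : IsNear (up (imageOn G S e)) (IsMark (imageOn G S e) M T χ') T (e v, 0) ↔
      IsNear (up G) (IsMark G M T χ) T (v, 0) :=
    exists_congr fun i => and_congr_right (hmark i)
  classical
  exact if_congr hnear rfl rfl

/-- The layers `ℓ` split into clusters of radius `R`: each node has a set of nodes of its own layer
within distance `R` that is at distance more than `T` from all other nodes of this layer. -/
def IsNetworkDecomposition (G : Digraph V) (T R : ℕ) (ℓ : V → ℕ) : Prop :=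
  ∀ u, ∃ C ⊆ ball G R u, u ∈ C ∧ ∀ w ∈ C, ℓ w = ℓ u ∧ ∀ w' ∈ ball G T w, ℓ w' = ℓ u → w' ∈ C

/-- The radius of the clusters formed by the two layers: an anchor is at most `5 * T + 1` steps
away. -/
def clusterRadius (T : ℕ) : ℕ := 10 * T + 2

theorem isNetworkDecomposition_layer (hG : IsRootedForest G) (hD : 2 * T ≤ D)
    (hχ : IsDistColoring G M D χ) :
    IsNetworkDecomposition G T (clusterRadius T) (layer G M T χ) := by
  have hcol := isOrbitColoring_extColor hG (Nat.succ_ne_zero (2 * T)) (Nat.succ_le_succ hD) hχ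
  have hgap : ∀ x, IsMark G M T χ x → ∀ i ≠ 0, i ≤ 2 * T → ¬ IsMark G M T χ ((up G)^[i] x) :=
    fun x hx i hi0 hi => hcol.not_marked_iterate hx hi0 (Nat.lt_succ_of_le hi)
  have hwindow : ∀ x, ∃ i, T < i ∧ i ≤ 5 * T + 1 ∧ IsMark G M T χ ((up G)^[i] x) := fun x => by
    obtain ⟨i, h1, h2, h3⟩ := exists_marked_iterate hcol.le x (T + 1)
    exact ⟨i, h1, by lia, h3⟩
  have hex : ∀ x, ∃ i, T < i ∧ IsMark G M T χ ((up G)^[i] x) :=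
    fun x => (hwindow x).imp fun _ h => ⟨h.1, h.2.2⟩
  have hheight : ∀ x, anchorHeight (up G) (IsMark G M T χ) T x ≤ 5 * T + 1 := fun x => by
    obtain ⟨i, h1, h2, h3⟩ := hwindow x
    exact (anchorHeight_le h1 h3).trans h2
  intro u
  refine ⟨{w | layer G M T χ w = layer G M T χ u ∧
    anchor (up G) (IsMark G M T χ) T (u, 0) = anchor (up G) (IsMark G M T χ) T (w, 0)}, ?_,
    ⟨rfl, rfl⟩, ?_⟩
  · rintro w ⟨-, hw⟩
    refine ball_mono ?_ u (mem_ball_of_iterate_up_eq hw)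
    have := hheight (u, 0)
    have := hheight (w, 0)
    rw [clusterRadius]
    lia
  · rintro w ⟨hlayer, hw⟩
    refine ⟨hlayer, fun w' hw' hlayer' => ⟨hlayer', hw.trans ?_⟩⟩
    obtain ⟨a, b, hab, heq⟩ := exists_iterate_up_eq hG hw'
    exact anchor_eq_anchor hgap hex hab heq (layer_eq_layer_iff.1 (hlayer.trans hlayer'.symm))

end Layers

section Records

variable {In Out V : Type}

open Classical in
/-- The record of `v` when `A` processes the nodes by increasing rank `ρ`. -/
def record {ι : Type*} [LT ι] [WellFoundedLT ι] (A : SLOCALAlgorithm In Out) (n T : ℕ)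
    (G : Digraph V) (ident : V → ℕ) (input : V → In) (ρ : V → ι) (v : V) : A.State × Out :=
  A.step n (viewOf G ident input T
    (fun w => if _h : ρ w < ρ v then some (record A n T G ident input ρ w) else none) v)
termination_by wellFounded_lt.wrap (ρ v)

variable (A : SLOCALAlgorithm In Out) (n T : ℕ) (G : Digraph V) (ident : V → ℕ) (input : V → In)

open Classical in
theorem foldl_process_eq_record {ι : Type*} [Preorder ι] [WellFoundedLT ι] {ρ : V → ι}
    {order : List V} (hsort : order.Pairwise fun v w => ρ v < ρ w)
    (hlt : ∀ v ∉ order, ∀ w ∈ order, ρ v < ρ w) {mem : V → Option (A.State × Out)}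
    (hmem : ∀ v, mem v = if v ∈ order then none else some (record A n T G ident input ρ v))
    (v : V) :
    order.foldl (A.process n T G ident input) mem v = some (record A n T G ident input ρ v) := by
  induction order generalizing mem with
  | nil => simpa using hmem v
  | cons a l ih =>
    obtain ⟨hal, hl⟩ := List.pairwise_cons.1 hsort
    have hstep : A.step n (viewOf G ident input T mem a) = record A n T G ident input ρ a := by
      rw [record]
      congr 2
      funext w
      have := hmem w
      have := hlt w
      grind
    refine ih hl (fun v hv w hw => ?_) fun v => ?_
    · by_cases hva : v = a
      · exact hva ▸ hal w hw
      · exact hlt v (by simp [hva, hv]) w (List.mem_cons_of_mem a hw)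
    · rw [SLOCALAlgorithm.process]
      by_cases hva : v = a
      · subst hva
        have hnot : v ∉ l := fun hv => (hal v hv).false
        rw [Function.update_self, if_neg hnot, hstep]
      · rw [Function.update_of_ne hva, hmem]
        simp [hva]

theorem exists_run_eq_record [Finite V] {ι : Type*} [LinearOrder ι] [WellFoundedLT ι] {ρ : V → ι}
    (hρ : Function.Injective ρ) :
    ∃ order : List V, order.Nodup ∧ (∀ v, v ∈ order) ∧
      ∀ v, A.run n T G ident input order v = some (record A n T G ident input ρ v) := by
  classical
  have := Fintype.ofFinite V
  let _ : LinearOrder V := LinearOrder.lift' ρ hρ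
  have hall : ∀ v, v ∈ (Finset.univ : Finset V).sort := fun v => by simp
  refine ⟨Finset.univ.sort, Finset.sort_nodup _ _, hall, fun v => ?_⟩
  exact foldl_process_eq_record A n T G ident input (ρ := ρ) (Finset.sortedLT_sort _).pairwise
    (fun v hv => absurd (hall v) hv) (fun v => (if_pos (hall v)).symm) v

end Records

section RecordsOfImages

variable {In Out V W : Type} {ι : Type*} [LT ι] [WellFoundedLT ι] {n T R : ℕ}
  {G : Digraph V} {S : Set V} {e : V → W} {ident : V → ℕ} {ident' : W → ℕ} {input : V → In}
  {input' : W → In} {v : V}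

theorem viewOf_imageOn {State : Type} (he : Set.InjOn e S) (hS : ball G T v ⊆ S)
    (hident : Set.EqOn (ident' ∘ e) ident (ball G T v))
    (hinput : Set.EqOn (input' ∘ e) input (ball G T v))
    {mem : V → Option (State × Out)} {mem' : W → Option (State × Out)}
    (hmem : Set.EqOn (mem' ∘ e) mem (ball G T v)) :
    viewOf (imageOn G S e) ident' input' T mem' (e v) = viewOf G ident input T mem v := by
  have hball : ∀ p : W → Prop, (∃ w ∈ ball (imageOn G S e) T (e v), p w) ↔
      ∃ a ∈ ball G T v, p (e a) := fun p => by
    rw [ball_imageOn he hS, Set.exists_mem_image]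
  have hident' : ∀ a ∈ ball G T v, ident' (e a) = ident a := hident
  have hinput' : ∀ a ∈ ball G T v, input' (e a) = input a := hinput
  have hmem' : ∀ a ∈ ball G T v, mem' (e a) = mem a := hmem
  rw [viewOf, viewOf, View.mk.injEq]
  refine ⟨hident (mem_ball_self _ _), ?_, ?_, ?_⟩ <;> ext p <;>
    simp only [Set.mem_ofPred_eq, hball]
  · refine exists_congr fun a => and_congr_right fun ha => ?_
    rw [hident' a ha, hinput' a ha]
  · refine exists_congr fun a => and_congr_right fun ha => exists_congr fun b =>
      and_congr_right fun hb => ?_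
    rw [hident' a ha, hident' b hb, imageOn_adj he (hS ha) (hS hb)]
  · refine exists_congr fun a => and_congr_right fun ha => ?_
    rw [hident' a ha, hmem' a ha]

variable (A : SLOCALAlgorithm In Out)

theorem record_imageOn_of_forall_lt (he : Set.InjOn e S) (hS : ball G T v ⊆ S)
    (hident : Set.EqOn (ident' ∘ e) ident (ball G T v))
    (hinput : Set.EqOn (input' ∘ e) input (ball G T v))
    {ρ : V → ι} {ρ' : W → ι} (hρ : Set.EqOn (ρ' ∘ e) ρ (ball G T v))
    (hlt : ∀ w ∈ ball G T v, ρ w < ρ v → record A n T (imageOn G S e) ident' input' ρ' (e w) =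
      record A n T G ident input ρ w) :
    record A n T (imageOn G S e) ident' input' ρ' (e v) = record A n T G ident input ρ v := by
  classical
  rw [record, record]
  congr 1
  refine viewOf_imageOn he hS hident hinput fun w hw => ?_
  have hiff : ρ' (e w) < ρ' (e v) ↔ ρ w < ρ v := by
    rw [show ρ' (e w) = ρ w from hρ hw, show ρ' (e v) = ρ v from hρ (mem_ball_self T v)]
  exact dite_congr (propext hiff) (fun h => congrArg some (hlt w hw h)) fun _ => rfl

/-- The rank that orders the nodes by their layer first, and by their color within a layer. -/
def rank (ℓ χ : V → ℕ) (v : V) : ℕ ×ₗ ℕ := toLex (ℓ v, χ v)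

/- Within a layer, information does not leave the clusters; so each layer adds `R + T` to the
distance from which a record depends on the graph. -/
theorem record_imageOn {ℓ χ : V → ℕ} (hℓ : IsNetworkDecomposition G T R ℓ) (he : Set.InjOn e S)
    {U : Set V} (hU : U ⊆ S) (hident : Set.EqOn (ident' ∘ e) ident U)
    (hinput : Set.EqOn (input' ∘ e) input U) {ρ : W → ℕ ×ₗ ℕ}
    (hρ : Set.EqOn (ρ ∘ e) (rank ℓ χ) U) (hball : ball G ((ℓ v + 1) * (R + T)) v ⊆ U) :
    record A n T (imageOn G S e) ident' input' ρ (e v) =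
      record A n T G ident input (rank ℓ χ) v := by
  induction hm : ℓ v using Nat.strong_induction_on generalizing v with | _ m ihlayer
  subst hm
  obtain ⟨C, hC, hvC, hclosed⟩ := hℓ v
  suffices hcluster : ∀ w ∈ C, record A n T (imageOn G S e) ident' input' ρ (e w) =
      record A n T G ident input (rank ℓ χ) w from hcluster v hvC
  intro w hw
  induction hc : χ w using Nat.strong_induction_on generalizing w with | _ c ihcolor
  subst hc
  obtain ⟨hlayer, hclosed⟩ := hclosed w hw
  have hsub : ball G T w ⊆ ball G (R + T) v := ball_subset_ball (hC hw)
  have hsubU : ball G T w ⊆ U :=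
    (hsub.trans (ball_mono (Nat.le_mul_of_pos_left _ (Nat.succ_pos _)) v)).trans hball
  refine record_imageOn_of_forall_lt A he (hsubU.trans hU) (hident.mono hsubU)
    (hinput.mono hsubU) (hρ.mono hsubU) fun a ha hlt => ?_
  rcases Prod.Lex.toLex_lt_toLex.1 hlt with hlt | ⟨heq, hlt⟩
  · rw [hlayer] at hlt
    refine ihlayer (ℓ a) hlt (((ball_subset_ball (hsub ha)).trans (ball_mono ?_ v)).trans hball) rfl
    calc R + T + (ℓ a + 1) * (R + T) = (ℓ a + 1 + 1) * (R + T) := by ring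
      _ ≤ (ℓ v + 1) * (R + T) := by gcongr; exact hlt
  · exact ihcolor _ hlt a (hclosed a ha (heq.trans hlayer)) rfl

/-- The record of a node in the run by increasing rank is determined by its neighborhood of this
radius: there are two layers. -/
def recordRadius (T : ℕ) : ℕ := 2 * (clusterRadius T + T)

theorem record_rank_layer_imageOn (hG : IsRootedForest G) {M D : ℕ} (hD : 2 * T ≤ D) {χ : V → ℕ}
    (hχ : IsDistColoring G M D χ) (he : Set.InjOn e S) {U : Set V} (hU : U ⊆ S)
    (hident : Set.EqOn (ident' ∘ e) ident U) (hinput : Set.EqOn (input' ∘ e) input U)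
    {ρ : W → ℕ ×ₗ ℕ} (hρ : Set.EqOn (ρ ∘ e) (rank (layer G M T χ) χ) U)
    (hball : ball G (recordRadius T) v ⊆ U) :
    record A n T (imageOn G S e) ident' input' ρ (e v) =
      record A n T G ident input (rank (layer G M T χ) χ) v := by
  refine record_imageOn A (isNetworkDecomposition_layer hG hD hχ) he hU hident hinput hρ
    ((ball_mono ?_ v).trans hball)
  rw [recordRadius]
  gcongr
  exact Nat.succ_le_succ (layer_le_one G M T χ v)

end RecordsOfImages

section LocalCheckability

variable {In Out V W : Type}

theorem CenteredLabeledGraph.Isomorphic.trans {H K L : CenteredLabeledGraph In Out}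
    (h : H.Isomorphic K) (h' : K.Isomorphic L) : H.Isomorphic L := by
  obtain ⟨φ, hcenter, hinput, hout⟩ := h
  obtain ⟨ψ, hcenter', hinput', hout'⟩ := h'
  refine ⟨φ.trans ψ, ?_, fun v => ?_, fun v => ?_⟩
  · rw [RelIso.trans_apply, hcenter, hcenter']
  · rw [RelIso.trans_apply, hinput', hinput]
  · rw [RelIso.trans_apply, hout', hout]

theorem localView_imageOn_isomorphic [Finite V] [Finite W] {G : Digraph V} {S : Set V} {e : V → W}
    (he : Set.InjOn e S) {r : ℕ} {v : V} (hS : ball G r v ⊆ S) {input : V → In} {input' : W → In}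
    (hinput : Set.EqOn (input' ∘ e) input (ball G r v)) {out : V → Out} {out' : W → Out}
    (hout : Set.EqOn (out' ∘ e) out (ball G r v)) :
    (localView G input out r v).Isomorphic (localView (imageOn G S e) input' out' r (e v)) := by
  have hbij : Set.BijOn e (ball G r v) (ball (imageOn G S e) r (e v)) := by
    rw [ball_imageOn he hS]
    exact (he.mono hS).bijOn_image
  exact ⟨⟨hbij.equiv e, fun {a b} => imageOn_adj he (hS a.2) (hS b.2)⟩, rfl,
    fun a => hinput a.2, fun a => hout a.2⟩

theorem LabelingProblem.IsLocallyCheckable.mem_permissible {P : LabelingProblem In Out} {r Δ : ℕ}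
    (hP : P.IsLocallyCheckable r Δ) [Finite V] {G : Digraph V} (hG : Loopless G)
    (hΔ : MaxDegreeLE G Δ) {input : V → In} {out : V → Out}
    (hlocal : ∀ v, ∃ (W : Type) (_ : Finite W) (H : Digraph W) (input' : W → In) (out' : W → Out)
      (w : W), Loopless H ∧ MaxDegreeLE H Δ ∧ out' ∈ P.permissible H input' ∧
        (localView G input out r v).Isomorphic (localView H input' out' r w)) :
    out ∈ P.permissible G input := by
  obtain ⟨𝒮, -, h𝒮⟩ := hP
  refine (h𝒮 V G input out hG hΔ).2 fun v => ?_
  obtain ⟨W, _, H, input', out', w, hH, hHΔ, hout', hiso⟩ := hlocal v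
  obtain ⟨K, hK, hiso'⟩ := (h𝒮 W H input' out' hH hHΔ).1 hout' w
  exact ⟨K, hK, hiso.trans hiso'⟩

theorem SLOCALAlgorithm.Solves.record_mem_permissible {A : SLOCALAlgorithm In Out}
    {P : LabelingProblem In Out} {Δ c : ℕ} {T : ℕ → ℕ} (hA : A.Solves P Δ c T) [Finite V]
    {G : Digraph V} (hG : IsRootedForest G) (hΔ : MaxDegreeLE G Δ) (input : V → In)
    {ident : V → ℕ} (hinj : Function.Injective ident)
    (hident : ∀ v, 1 ≤ ident v ∧ ident v ≤ Nat.card V ^ c) {ι : Type*} [LinearOrder ι]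
    [WellFoundedLT ι] {ρ : V → ι} (hρ : Function.Injective ρ) :
    (fun v => (record A (Nat.card V) (T (Nat.card V)) G ident input ρ v).2) ∈
      P.permissible G input := by
  obtain ⟨order, hnodup, hall, hrun⟩ :=
    exists_run_eq_record A (Nat.card V) (T (Nat.card V)) G ident input hρ
  obtain ⟨out, hout, hsolve⟩ := hA V G hG hΔ input ident hinj hident order hnodup hall
  convert hout using 2 with v
  simpa [hrun] using hsolve v

/- Around each node, the colors are identifiers of a graph with exactly `n` nodes, on which `A`
is correct. -/
theorem SLOCALAlgorithm.Solves.record_rank_layer_mem_permissible {A : SLOCALAlgorithm In Out}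
    {P : LabelingProblem In Out} {r Δ c : ℕ} {T : ℕ → ℕ} (hA : A.Solves P Δ c T) (hc : 1 ≤ c)
    (hP : P.IsLocallyCheckable r Δ) [Finite V] {G : Digraph V} (hG : IsRootedForest G)
    (hΔ : MaxDegreeLE G Δ) {n D : ℕ} (hD : 2 * (r + recordRadius (T n)) ≤ D) {χ : V → ℕ}
    (hχ : IsDistColoring G n D χ) (input : V → In) :
    (fun v => (record A n (T n) G χ input (rank (layer G n (T n) χ) χ) v).2) ∈
      P.permissible G input := by
  refine hP.mem_permissible hG.loopless hΔ fun z => ?_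
  have : Nonempty V := ⟨z⟩
  let e : V → Finset.Icc 1 n :=
    fun v => ⟨χ v, Finset.mem_Icc.2 ⟨Nat.one_le_iff_ne_zero.2 (hχ.ne_zero v), hχ.le v⟩⟩
  let S := ball G (r + recordRadius (T n)) z
  have he : Set.InjOn e S := fun a ha b hb hab =>
    hχ.injOn_ball hD z ha hb (congrArg Subtype.val hab)
  let g : Finset.Icc 1 n → V := Function.invFunOn e S
  have hge : Set.EqOn (g ∘ e) id S := he.leftInvOn_invFunOn
  let ρ : Finset.Icc 1 n → ℕ ×ₗ ℕ := fun x => toLex (layer G n (T n) χ (g x), x)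
  have hρ : Function.Injective ρ := fun x y hxy =>
    Subtype.ext (congrArg (fun p => (ofLex p).2) hxy)
  have hcard : Nat.card (Finset.Icc 1 n) = n := by
    rw [Nat.card_eq_fintype_card, Fintype.card_coe, Nat.card_Icc, Nat.add_sub_cancel]
  have hinput : Set.EqOn ((input ∘ g) ∘ e) input S := fun a ha => congrArg input (hge ha)
  have hrS : ball G r z ⊆ S := ball_mono (Nat.le_add_right _ _) z
  have hG' := isRootedForest_imageOn he hG
  have hΔ' := maxDegreeLE_imageOn he hΔ
  have hsolve := hA.record_mem_permissible hG' hΔ' (input ∘ g) Subtype.val_injective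
    (fun x => ⟨(Finset.mem_Icc.1 x.2).1, by
      rw [hcard]
      exact (Finset.mem_Icc.1 x.2).2.trans (Nat.le_self_pow (by lia) n)⟩) hρ
  rw [hcard] at hsolve
  refine ⟨_, inferInstance, _, _, _, e z, hG'.loopless, hΔ', hsolve,
    localView_imageOn_isomorphic he hrS (hinput.mono hrS) fun a ha => congrArg Prod.snd ?_⟩
  refine record_rank_layer_imageOn A hG ?_ hχ he subset_rfl (fun _ _ => rfl) hinput
    (fun b hb => ?_) (ball_subset_ball ha)
  · rw [recordRadius] at hD
    lia
  · simp only [ρ, Function.comp_apply, rank, show g (e b) = b from hge hb, e]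

end LocalCheckability

section SimulatedSize

theorem eventually_pow_le {Δ : ℕ} (hΔ : 2 ≤ Δ) {T : ℕ → ℕ}
    (hT : (fun n : ℕ => (T n : ℝ)) =o[atTop] (fun n : ℕ => Real.logb (Δ : ℝ) (n : ℝ)))
    (a b : ℕ) : ∀ᶠ n in atTop, (Δ + 1) ^ (a * T n + b) ≤ n := by
  have hΔ1 : (1 : ℝ) < Δ := by exact_mod_cast hΔ
  have hlog : Tendsto (fun n : ℕ => Real.logb (Δ : ℝ) n) atTop atTop :=
    (Real.tendsto_logb_atTop hΔ1).comp tendsto_natCast_atTop_atTop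
  have hb : (fun _ : ℕ => (b : ℝ)) =o[atTop] (fun n : ℕ => Real.logb (Δ : ℝ) n) :=
    isLittleO_const_left.2 (Or.inr (tendsto_norm_atTop_atTop.comp hlog))
  filter_upwards [((hT.const_mul_left (a : ℝ)).add hb).def one_half_pos,
    hlog.eventually_ge_atTop 0, eventually_gt_atTop 0] with n hn hn0 hnpos
  rw [Real.norm_of_nonneg (by positivity), Real.norm_of_nonneg hn0] at hn
  have hpow : Δ ^ (2 * (a * T n + b)) ≤ n := by
    have hle : ((2 * (a * T n + b) : ℕ) : ℝ) ≤ Real.logb Δ n := by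
      push_cast
      linarith
    rw [Real.le_logb_iff_rpow_le hΔ1 (by exact_mod_cast hnpos), Real.rpow_natCast] at hle
    exact_mod_cast hle
  calc (Δ + 1) ^ (a * T n + b) ≤ (Δ ^ 2) ^ (a * T n + b) := Nat.pow_le_pow_left (by nlinarith) _
    _ = Δ ^ (2 * (a * T n + b)) := (pow_mul _ _ _).symm
    _ ≤ n := hpow

end SimulatedSize

section Views

variable {In Out State V : Type} {G : Digraph V} {ident : V → ℕ} {input : V → In}
  {mem : V → Option (State × Out)} {v : V}

/-- The graph that is seen in a view, with the identifiers as nodes. -/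
def viewGraph (w : View In Out State) : Digraph ℕ where
  Adj a b := (a, b) ∈ w.edges

/-- The input label of the node with identifier `a` in a view, arbitrary if there is none. -/
def viewInput [Nonempty In] (w : View In Out State) (a : ℕ) : In :=
  Classical.epsilon fun i => (a, i) ∈ w.inputs

theorem viewGraph_viewOf (G : Digraph V) (ident : V → ℕ) (input : V → In) (k : ℕ)
    (mem : V → Option (State × Out)) (v : V) :
    viewGraph (viewOf G ident input k mem v) = imageOn G (ball G k v) ident := by
  ext a b
  simp [viewGraph, viewOf, imageOn, eq_comm]

theorem viewInput_viewOf [Nonempty In] (hinj : Function.Injective ident) (k : ℕ) :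
    Set.EqOn (viewInput (viewOf G ident input k mem v) ∘ ident) input (ball G k v) := by
  intro a ha
  have hex : ∃ i, (ident a, i) ∈ (viewOf G ident input k mem v).inputs := ⟨input a, a, ha, rfl⟩
  obtain ⟨b, -, hb⟩ := Classical.epsilon_spec hex
  obtain ⟨hab, hinput⟩ := Prod.ext_iff.1 hb
  exact hinput.trans (congrArg input (hinj hab).symm)

theorem ball_viewGraph_viewOf (hinj : Function.Injective ident) {K k : ℕ} (hk : K ≤ k) :
    ball (viewGraph (viewOf G ident input k mem v)) K (ident v) = ident '' ball G K v := by
  rw [viewGraph_viewOf]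
  exact ball_imageOn hinj.injOn (ball_mono hk v)

end Views

section ColorFirst

variable {In Out V : Type} {M D K : ℕ}

/-- `col` properly colors the radius-`K` neighborhood of the center of the view `w`, and extends
the partial colorings recorded in `w`. -/
structure ExtendsColoring (M D K : ℕ) (w : View In Out (ℕ → ℕ)) (col : ℕ → ℕ) : Prop where
  eq : ∀ p ∈ w.memory, ∀ a, p.2.1 a ≠ 0 → col a = p.2.1 a
  ne_zero : ∀ a ∈ ball (viewGraph w) K w.center, col a ≠ 0
  le : ∀ a ∈ ball (viewGraph w) K w.center, col a ≤ M
  ne : ∀ a ∈ ball (viewGraph w) K w.center, ∀ b ∈ ball (viewGraph w) D a, a ≠ b → col a ≠ col b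

/-- A coloring that extends those recorded in the view `w`, arbitrary if there is none. -/
def chooseColoring (M D K : ℕ) (w : View In Out (ℕ → ℕ)) : ℕ → ℕ :=
  Classical.epsilon (ExtendsColoring M D K w)

/-- The algorithm that greedily extends a distance-`D` coloring with `M` colors to the radius-`K`
neighborhood of the current node, records it as the state, and computes the output from it by
`F`. -/
def colorFirst (M D K : ℕ) (F : View In Out (ℕ → ℕ) → (ℕ → ℕ) → Out) : SLOCALAlgorithm In Out where
  State := ℕ → ℕ
  step _ w := ((ball (viewGraph w) K w.center).indicator (chooseColoring M D K w),
    F w (chooseColoring M D K w))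

variable {G : Digraph V} {ident : V → ℕ} {input : V → In}

theorem extendsColoring_viewOf_iff (hinj : Function.Injective ident)
    {mem : V → Option ((ℕ → ℕ) × Out)} {v : V} {col : ℕ → ℕ} :
    ExtendsColoring M D K (viewOf G ident input (2 * K + D) mem v) col ↔
      (∀ u ∈ ball G (2 * K + D) v, ∀ p, mem u = some p → ∀ a, p.1 a ≠ 0 → col a = p.1 a) ∧
      ∀ a ∈ ball G K v, col (ident a) ≠ 0 ∧ col (ident a) ≤ M ∧
        ∀ b ∈ ball G D a, a ≠ b → col (ident a) ≠ col (ident b) := by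
  have hcenter : (viewOf G ident input (2 * K + D) mem v).center = ident v := rfl
  have hballK := ball_viewGraph_viewOf (input := input) (mem := mem) (G := G) (v := v) hinj
    (show K ≤ 2 * K + D by lia)
  have hballD : ∀ a ∈ ball G K v,
      ball (viewGraph (viewOf G ident input (2 * K + D) mem v)) D (ident a) =
        ident '' ball G D a := fun a ha => by
    rw [viewGraph_viewOf]
    exact ball_imageOn hinj.injOn ((ball_subset_ball ha).trans (ball_mono (by lia) v))
  constructor
  · rintro ⟨heq, hne_zero, hle, hne⟩
    rw [hcenter, hballK] at hne_zero hle hne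
    refine ⟨fun u hu p hp => heq _ ⟨u, hu, p, hp, rfl⟩, fun a ha =>
      ⟨hne_zero _ ⟨a, ha, rfl⟩, hle _ ⟨a, ha, rfl⟩, fun b hb hab => ?_⟩⟩
    refine hne _ ⟨a, ha, rfl⟩ _ ?_ (hinj.ne hab)
    rw [hballD a ha]
    exact ⟨b, hb, rfl⟩
  · rintro ⟨heq, hcol⟩
    refine ⟨?_, ?_, ?_, ?_⟩
    · rintro _ ⟨u, hu, p, hp, rfl⟩
      exact heq u hu p hp
    all_goals
      rw [hcenter, hballK]
      rintro _ ⟨a, ha, rfl⟩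
    · exact (hcol a ha).1
    · exact (hcol a ha).2.1
    · rw [hballD a ha]
      rintro _ ⟨b, hb, rfl⟩ hab
      exact (hcol a ha).2.2 b hb (ne_of_apply_ne ident hab)

/-- The records of `colorFirst` are those of the partial coloring `χ`, which is defined on the
radius-`K` neighborhoods of the processed nodes. -/
structure RecordsColoring (M D K : ℕ) (F : View In Out (ℕ → ℕ) → (ℕ → ℕ) → Out) (G : Digraph V)
    (ident : V → ℕ) (input : V → In) (mem : V → Option ((ℕ → ℕ) × Out)) (χ : V → ℕ) : Prop where
  coloring : IsPartialColoring G M D χ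
  ne_zero_iff : ∀ a, χ a ≠ 0 ↔ ∃ u, (mem u).isSome ∧ a ∈ ball G K u
  state_eq : ∀ u p, mem u = some p → p.1 = Function.extend ident ((ball G K u).indicator χ) 0
  output_eq : ∀ u p, mem u = some p → ∃ mem' col, Set.EqOn (col ∘ ident) χ (ball G K u) ∧
    p.2 = F (viewOf G ident input (2 * K + D) mem' u) col

variable {F : View In Out (ℕ → ℕ) → (ℕ → ℕ) → Out} {mem : V → Option ((ℕ → ℕ) × Out)} {χ : V → ℕ}

theorem RecordsColoring.exists_extendsColoring [Finite V] (hball : ∀ v, (ball G D v).ncard ≤ M)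
    (hinj : Function.Injective ident) (hmem : RecordsColoring M D K F G ident input mem χ) (v : V) :
    ∃ col, ExtendsColoring M D K (viewOf G ident input (2 * K + D) mem v) col := by
  obtain ⟨χ', hχ', hext, hdom⟩ := hmem.coloring.exists_extension hball (ball G K v)
  refine ⟨Function.extend ident χ' 0, (extendsColoring_viewOf_iff hinj).2 ⟨?_, fun a ha => ?_⟩⟩
  · rintro u - p hp x hx
    rw [hmem.state_eq u p hp] at hx ⊢
    by_cases hrange : ∃ a, ident a = x
    · obtain ⟨a, rfl⟩ := hrange
      rw [hinj.extend_apply] at hx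
      rw [hinj.extend_apply, hinj.extend_apply]
      have hindicator := Set.indicator_of_mem (Set.mem_of_indicator_ne_zero hx) χ
      rw [hindicator] at hx ⊢
      exact hext a hx
    · exact absurd (Function.extend_apply' _ _ _ hrange) hx
  · simp only [hinj.extend_apply]
    have hne : χ' a ≠ 0 := (hdom a).2 (Or.inr ha)
    exact ⟨hne, hχ'.le a, fun b hb hab => hχ'.ne a b hb hab hne⟩

theorem RecordsColoring.eq_of_extendsColoring (hinj : Function.Injective ident)
    (hmem : RecordsColoring M D K F G ident input mem χ) {v : V} {col : ℕ → ℕ}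
    (hcol : ExtendsColoring M D K (viewOf G ident input (2 * K + D) mem v) col) {a : V}
    (ha : a ∈ ball G (K + D) v) (hχa : χ a ≠ 0) : col (ident a) = χ a := by
  obtain ⟨u, hu, hau⟩ := (hmem.ne_zero_iff a).1 hχa
  obtain ⟨p, hp⟩ := Option.isSome_iff_exists.1 hu
  have hstate : p.1 (ident a) = χ a := by
    rw [hmem.state_eq u p hp, hinj.extend_apply, Set.indicator_of_mem hau]
  have huv : u ∈ ball G (2 * K + D) v :=
    ball_mono (by lia) v (mem_ball_trans ha (mem_ball_symm hau))
  rw [← hstate]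
  exact ((extendsColoring_viewOf_iff hinj).1 hcol).1 u huv p hp _ (hstate ▸ hχa)

open Classical in
theorem RecordsColoring.isPartialColoring_piecewise (hinj : Function.Injective ident)
    (hmem : RecordsColoring M D K F G ident input mem χ) {v : V} {col : ℕ → ℕ}
    (hcol : ExtendsColoring M D K (viewOf G ident input (2 * K + D) mem v) col) :
    IsPartialColoring G M D ((ball G K v).piecewise (col ∘ ident) χ) := by
  have hball := ((extendsColoring_viewOf_iff hinj).1 hcol).2
  refine hmem.coloring.of_eqOn_compl (F := ball G K v) (fun a ha => ?_) (fun a ha => ?_)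
    fun a ha b hb hab _ => ?_
  · exact Set.piecewise_eq_of_notMem _ _ _ ha
  · rw [Set.piecewise_eq_of_mem _ _ _ ha]
    exact (hball a ha).2.1
  · rw [Set.piecewise_eq_of_mem _ _ _ ha]
    by_cases hbv : b ∈ ball G K v
    · rw [Set.piecewise_eq_of_mem _ _ _ hbv]
      exact (hball a ha).2.2 b hb hab
    · rw [Set.piecewise_eq_of_notMem _ _ _ hbv]
      by_cases hχb : χ b = 0
      · exact hχb ▸ (hball a ha).1
      · rw [← hmem.eq_of_extendsColoring hinj hcol (mem_ball_trans ha hb) hχb]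
        exact (hball a ha).2.2 b hb hab

end ColorFirst

section ColorFirstRun

variable {In Out V : Type}

theorem indicator_image_eq_extend {α β γ : Type*} [Zero γ] {f : α → β} (hf : Function.Injective f)
    (s : Set α) (g : β → γ) :
    (f '' s).indicator g = Function.extend f (s.indicator (g ∘ f)) 0 := by
  classical
  funext x
  by_cases hx : ∃ a, f a = x
  · obtain ⟨a, rfl⟩ := hx
    simp only [hf.extend_apply, Set.indicator_apply, hf.mem_set_image, Function.comp_apply]
  · rw [Function.extend_apply' _ _ _ hx, Pi.zero_apply, Set.indicator_of_notMem]
    rintro ⟨a, -, ha⟩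
    exact hx ⟨a, ha⟩

variable {M D K : ℕ} {F : View In Out (ℕ → ℕ) → (ℕ → ℕ) → Out} {G : Digraph V} {ident : V → ℕ}
  {input : V → In} {mem : V → Option ((ℕ → ℕ) × Out)} {χ : V → ℕ}

theorem RecordsColoring.update (hmem : RecordsColoring M D K F G ident input mem χ) [DecidableEq V]
    {v : V} {χ' : V → ℕ} (hχ' : IsPartialColoring G M D χ') (hext : ∀ a, χ a ≠ 0 → χ' a = χ a)
    (hdom : ∀ a, χ' a ≠ 0 ↔ χ a ≠ 0 ∨ a ∈ ball G K v) {mem' : V → Option ((ℕ → ℕ) × Out)}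
    {col : ℕ → ℕ} (hcol : Set.EqOn (col ∘ ident) χ' (ball G K v)) :
    RecordsColoring M D K F G ident input
      (Function.update mem v (some (Function.extend ident ((ball G K v).indicator χ') 0,
        F (viewOf G ident input (2 * K + D) mem' v) col))) χ' := by
  have heqOn : ∀ u p, mem u = some p → Set.EqOn χ' χ (ball G K u) := fun u p hp a ha =>
    hext a ((hmem.ne_zero_iff a).2 ⟨u, by simp [hp], ha⟩)
  refine ⟨hχ', fun a => ?_, fun u p hp => ?_, fun u p hp => ?_⟩
  · rw [hdom, hmem.ne_zero_iff]
    constructor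
    · rintro (⟨u, hu, ha⟩ | ha)
      · refine ⟨u, ?_, ha⟩
        rw [Function.update_apply]
        split_ifs
        exacts [rfl, hu]
      · exact ⟨v, by simp, ha⟩
    · rintro ⟨u, hu, ha⟩
      by_cases huv : u = v
      · exact Or.inr (huv ▸ ha)
      · exact Or.inl ⟨u, by rwa [Function.update_of_ne huv] at hu, ha⟩
  · by_cases huv : u = v
    · subst huv
      rw [Function.update_self, Option.some_inj] at hp
      rw [← hp]
    · rw [Function.update_of_ne huv] at hp
      rw [hmem.state_eq u p hp, Set.indicator_congr (heqOn u p hp)]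
  · by_cases huv : u = v
    · subst huv
      rw [Function.update_self, Option.some_inj] at hp
      exact ⟨mem', col, hcol, by rw [← hp]⟩
    · rw [Function.update_of_ne huv] at hp
      obtain ⟨mem₀, col₀, hcol₀, hout⟩ := hmem.output_eq u p hp
      exact ⟨mem₀, col₀, hcol₀.trans (heqOn u p hp).symm, hout⟩

theorem RecordsColoring.process [Finite V] (hball : ∀ v, (ball G D v).ncard ≤ M)
    (hinj : Function.Injective ident) (N : ℕ)
    (hmem : RecordsColoring M D K F G ident input mem χ) (v : V) :
    ∃ χ', RecordsColoring M D K F G ident input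
      ((colorFirst M D K F).process N (2 * K + D) G ident input mem v) χ' := by
  classical
  set w := viewOf G ident input (2 * K + D) mem v
  have hcol : ExtendsColoring M D K w (chooseColoring M D K w) :=
    Classical.epsilon_spec (hmem.exists_extendsColoring hball hinj v)
  set col := chooseColoring M D K w
  set χ' := (ball G K v).piecewise (col ∘ ident) χ
  have hin : Set.EqOn χ' (col ∘ ident) (ball G K v) := Set.piecewise_eqOn _ _ _
  have hout : ∀ a ∉ ball G K v, χ' a = χ a := fun a ha => Set.piecewise_eq_of_notMem _ _ _ ha
  have hpos : ∀ a ∈ ball G K v, χ' a ≠ 0 := fun a ha => by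
    rw [hin ha]
    exact (((extendsColoring_viewOf_iff hinj).1 hcol).2 a ha).1
  have hext : ∀ a, χ a ≠ 0 → χ' a = χ a := fun a hχa => by
    by_cases ha : a ∈ ball G K v
    · exact (hin ha).trans
        (hmem.eq_of_extendsColoring hinj hcol (ball_mono (Nat.le_add_right K D) v ha) hχa)
    · exact hout a ha
  have hdom : ∀ a, χ' a ≠ 0 ↔ χ a ≠ 0 ∨ a ∈ ball G K v := fun a => by
    have := hpos a
    have := hout a
    have := hext a
    grind
  have hstate : (ball (viewGraph w) K w.center).indicator col =
      Function.extend ident ((ball G K v).indicator χ') 0 := by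
    rw [show w.center = ident v from rfl, ball_viewGraph_viewOf hinj (by lia),
      indicator_image_eq_extend hinj, Set.indicator_congr hin]
  refine ⟨χ', ?_⟩
  convert hmem.update (hmem.isPartialColoring_piecewise hinj hcol) hext hdom (mem' := mem) hin.symm
    using 1
  rw [← hstate]
  rfl

theorem RecordsColoring.exists_foldl [Finite V] (hball : ∀ v, (ball G D v).ncard ≤ M)
    (hinj : Function.Injective ident) (N : ℕ) (order : List V)
    (hmem : RecordsColoring M D K F G ident input mem χ) :
    ∃ χ', RecordsColoring M D K F G ident input
      (order.foldl ((colorFirst M D K F).process N (2 * K + D) G ident input) mem) χ' := by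
  induction order generalizing mem χ with
  | nil => exact ⟨χ, hmem⟩
  | cons v order ih =>
    obtain ⟨χ', hχ'⟩ := hmem.process hball hinj N v
    exact ih hχ'

theorem isSome_foldl_process (A : SLOCALAlgorithm In Out) (n T : ℕ) (G : Digraph V)
    (ident : V → ℕ) (input : V → In) (order : List V) (mem : V → Option (A.State × Out)) (v : V) :
    (order.foldl (A.process n T G ident input) mem v).isSome ↔ (mem v).isSome ∨ v ∈ order := by
  classical
  induction order generalizing mem with
  | nil => simp
  | cons w order ih =>
    rw [List.foldl_cons, ih, SLOCALAlgorithm.process, Function.update_apply]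
    by_cases hvw : v = w <;> simp [hvw]

theorem exists_isDistColoring_run_colorFirst [Finite V] (hball : ∀ v, (ball G D v).ncard ≤ M)
    (hinj : Function.Injective ident) (input : V → In) (N : ℕ) {order : List V}
    (hall : ∀ v, v ∈ order) : ∃ χ, IsDistColoring G M D χ ∧ ∀ v, ∃ mem col,
      Set.EqOn (col ∘ ident) χ (ball G K v) ∧
        ((colorFirst M D K F).run N (2 * K + D) G ident input order v).map Prod.snd =
          some (F (viewOf G ident input (2 * K + D) mem v) col) := by
  have hempty : RecordsColoring M D K F G ident input (fun _ => none) 0 :=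
    ⟨⟨fun _ => Nat.zero_le _, fun _ _ _ _ h => absurd rfl h⟩, by simp, by simp, by simp⟩
  obtain ⟨χ, hχ⟩ := hempty.exists_foldl hball hinj N order
  have hsome : ∀ v, (order.foldl ((colorFirst M D K F).process N (2 * K + D) G ident input)
      (fun _ => none) v).isSome := fun v =>
    (isSome_foldl_process _ _ _ G ident input order _ v).2 (Or.inr (hall v))
  refine ⟨χ, ⟨hχ.coloring, fun v => (hχ.ne_zero_iff v).2 ⟨v, hsome v, mem_ball_self K v⟩⟩,
    fun v => ?_⟩
  obtain ⟨p, hp⟩ := Option.isSome_iff_exists.1 (hsome v)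
  obtain ⟨mem, col, hcol, hout⟩ := hχ.output_eq v p hp
  exact ⟨mem, col, hcol, by rw [← hout]; exact congrArg (Option.map Prod.snd) hp⟩

end ColorFirstRun

section Simulator

variable {In Out V : Type} [Nonempty In]

/-- The output at the center of the view `w` in a run of `A` on `n` nodes by increasing rank, in
which the colors serve as identifiers. -/
def simulatedOutput (A : SLOCALAlgorithm In Out) (n T : ℕ) {State : Type} (w : View In Out State)
    (col : ℕ → ℕ) : Out :=
  (record A n T (viewGraph w) col (viewInput w) (rank (layer (viewGraph w) n T col) col)
    w.center).2

theorem simulatedOutput_viewOf (A : SLOCALAlgorithm In Out) {n T D K k : ℕ} (hD : 2 * T ≤ D)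
    (hK : recordRadius T + layerRadius n T ≤ K) (hk : K ≤ k) {G : Digraph V}
    (hG : IsRootedForest G) {χ : V → ℕ} (hχ : IsDistColoring G n D χ) {ident : V → ℕ}
    (hinj : Function.Injective ident) (input : V → In) {State : Type}
    (mem : V → Option (State × Out)) {v : V} {col : ℕ → ℕ}
    (hcol : Set.EqOn (col ∘ ident) χ (ball G K v)) :
    simulatedOutput A n T (viewOf G ident input k mem v) col =
      (record A n T G χ input (rank (layer G n T χ) χ) v).2 := by
  have hsub : ball G K v ⊆ ball G k v := ball_mono hk v
  have hsubK : ball G (recordRadius T) v ⊆ ball G K v := ball_mono (by lia) v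
  have hrank : Set.EqOn (rank (layer (imageOn G (ball G k v) ident) n T col) col ∘ ident)
      (rank (layer G n T χ) χ) (ball G (recordRadius T) v) := fun a ha => by
    have haK : ball G (layerRadius n T) a ⊆ ball G K v :=
      (ball_subset_ball ha).trans (ball_mono hK v)
    rw [Function.comp_apply, rank, rank, show col (ident a) = χ a from hcol (hsubK ha),
      layer_imageOn hG hinj.injOn (haK.trans hsub) hχ.le (hcol.mono haK)]
  rw [simulatedOutput, viewGraph_viewOf]
  exact congrArg Prod.snd (record_rank_layer_imageOn A hG hD hχ hinj.injOn (hsubK.trans hsub)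
    (hcol.mono hsubK) ((viewInput_viewOf hinj k).mono (hsubK.trans hsub)) hrank subset_rfl)

end Simulator

section Simulator

variable {In Out : Type} {A : SLOCALAlgorithm In Out} {P : LabelingProblem In Out} {Δ c : ℕ}
  {T : ℕ → ℕ}

theorem SLOCALAlgorithm.Solves.colorFirst_simulatedOutput [Nonempty In] (hA : A.Solves P Δ c T)
    (hc : 1 ≤ c) {r : ℕ} (hP : P.IsLocallyCheckable r Δ) {n D : ℕ}
    (hD : 2 * (r + recordRadius (T n)) ≤ D) (hn : (Δ + 1) ^ D ≤ n) (c' : ℕ) :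
    let K := recordRadius (T n) + layerRadius n (T n)
    (colorFirst n D K (simulatedOutput A n (T n))).Solves P Δ c' (fun _ => 2 * K + D) := by
  intro K V _ G hG hΔ input ident hinj _ order _ hall
  obtain ⟨χ, hχ, hrun⟩ := exists_isDistColoring_run_colorFirst (M := n) (K := K)
    (F := simulatedOutput A n (T n)) (fun v => (ncard_ball_le hΔ D v).trans hn) hinj input
    (Nat.card V) hall
  refine ⟨_, hA.record_rank_layer_mem_permissible hc hP hG hΔ hD hχ input, fun v => ?_⟩
  obtain ⟨mem, col, hcol, hout⟩ := hrun v
  have hTD : 2 * T n ≤ D := by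
    rw [recordRadius] at hD
    lia
  rw [hout, simulatedOutput_viewOf A hTD le_rfl (by lia) hG hχ hinj input mem hcol]

theorem SLOCALAlgorithm.Solves.of_isEmpty [IsEmpty In] (hA : A.Solves P Δ c T) (c' : ℕ)
    (T' : ℕ → ℕ) : A.Solves P Δ c' T' := by
  intro V _ G hG hΔ input ident hinj _ order hnodup hall
  have : IsEmpty V := Function.isEmpty input
  obtain ⟨out, hout, -⟩ := hA V G hG hΔ input ident hinj isEmptyElim order hnodup hall
  exact ⟨out, hout, isEmptyElim⟩

end Simulator

end LCLModel

end

theorem mainTheorem7_general {In Out : Type}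
    (P : LCLModel.LabelingProblem In Out) (r Δ c : ℕ) (hΔ : 2 ≤ Δ) (hc : 1 ≤ c)
    (hP : P.IsLocallyCheckable r Δ) (A : LCLModel.SLOCALAlgorithm In Out) (T : ℕ → ℕ)
    (hT : (fun n : ℕ => (T n : ℝ)) =o[atTop] (fun n : ℕ => Real.logb (Δ : ℝ) (n : ℝ)))
    (hA : A.Solves P Δ c T) :
    ∃ (B : LCLModel.SLOCALAlgorithm In Out) (k : ℕ), ∀ c', B.Solves P Δ c' (fun _ => k) := by
  rcases isEmpty_or_nonempty In with hIn | hIn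
  · exact ⟨A, 0, fun c' => hA.of_isEmpty c' _⟩
  · obtain ⟨n, hn⟩ := (LCLModel.eventually_pow_le hΔ hT 44 (2 * (r + 4))).exists
    have hD : 2 * (r + LCLModel.recordRadius (T n)) = 44 * T n + 2 * (r + 4) := by
      rw [LCLModel.recordRadius, LCLModel.clusterRadius]
      ring
    exact ⟨_, _, hA.colorFirst_simulatedOutput hc hP hD.le hn⟩

theorem mainTheorem7 {In Out : Type} [Finite In] [Finite Out]
    (P : LCLModel.LabelingProblem In Out) (r Δ c : ℕ) (hΔ : 2 ≤ Δ) (hc : 1 ≤ c)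
    (hP : P.IsLocallyCheckable r Δ)
    (A : LCLModel.SLOCALAlgorithm In Out) (T : ℕ → ℕ)
    (hT : (fun n : ℕ => (T n : ℝ)) =o[atTop] (fun n : ℕ => Real.logb (Δ : ℝ) (n : ℝ)))
    (hA : A.Solves P Δ c T) :
    ∃ (B : LCLModel.SLOCALAlgorithm In Out) (k : ℕ), B.Solves P Δ c (fun _ => k) := by
  obtain ⟨B, k, hB⟩ := mainTheorem7_general P r Δ c hΔ hc hP A T hT hA
  exact ⟨B, k, hB c⟩
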